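/- A (non-planar rooted) tree $T$ is a finite connected acyclic graph with edges directed towards a distinguished outer edge, the root; edges may be attached to two vertices (inner edges) or fewer (outer edges: the root and the leaves), every vertex has exactly one outgoing edge, and the root is the only edge without a vertex at its lower end. Let $\Omega[T]$ be the symmetric coloured operad whose colours are the edges of $T$ and which is freely generated by one operation for each vertex $v$, from the incoming edges of $v$ to its outgoing edge. Let $\Omega$ be the category of trees, with $\Omega(S,T)$ the set of operad maps $\Omega[S]\to\Omega[T]$. Let $\mathtt{SC^*_{un}}$ be the category of nonzero separable unital $C^*$-algebras and unital $*$-homomorphisms. The modified tree of $T$ is the directed graph obtained by inserting a vertex at the tip of every leaf and at the bottom of the root. A path is a sequence of edges $e_1e_2\cdots e_n$ such that the source of $e_i$ is the range of $e_{i+1}$ for all $i<n$. Let $D(T)$ be the universal unital $C^*$-algebra generated by elements $q_e$, one for each edge $e$ of the modified tree (equivalently, of $T$), subject to the relations: (1) $q_e\ge 0$ for all $e$; (2) $\sum_e q_e=1$; (3) $q_{e_1}q_{e_2}\cdots q_{e_n}=0$ (repetitions allowed) unless there is a path that traverses all of $e_1,\dots,e_n$. **Proposition 2.5.** For every tree $T$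 the universal algebra $D(T)$ exists and is nonzero and separable, and $T\mapsto D(T)$ extends to a functor $D:\Omega\to\mathtt{SC^*_{un}}^{\mathrm{op}}$, $\tau\mapsto\tau^*$, such that * for an inner face $\partial_e:T/e\to T$ (contraction of an inner edge $e$), $\partial_e^*(q_f)=q_f$ for $f\ne e$ and $\partial_e^*(q_e)=0$; * for an outer face $\partial_v:T/v\to T$ (deletion of a vertex $v$ with exactly one inner edge attached to it, together with all outer edges attached to $v$), $\partial_v^*(q_f)=q_f$ if $f$ has not been removed and $\partial_v^*(q_f)=0$ otherwise; likewise, for the map from the unit tree (one edge $*$, no vertex) to $T$ that picks an edge $e$ (an outer face if $T$ has exactly one vertex), $q_e\mapsto q_*$ and $q_f\mapsto 0$ for $f\neq e$; * for a degeneracy $\sigma_v:T\to T\backslash v$ (deletion of a vertex $v$ with exactly one incoming edge $e_1$, merging $e_1$ and the outgoing edge $e_2$ of $v$ into one edge $e$), $\sigma_v^*(q_e)=q_{e_1}+q_{e_2}$ and $\sigma_v^*(q_f)=q_f$ for $f\ne e$; * for an isomorphism $\theta:S\to T$, $\theta^*(q_e)=q_{\theta^{-1}(e)}$; * for an arbitrary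 morphism $\tau:S\to T$ of $\Omega$, $\tau^*(q_e)=\sum_{f\,:\,\tau(f)=e}q_f$, the sum being over the edges $f$ of $S$ that $\tau$ sends to $e$. -/

import Mathlib

open CategoryTheory

universe u v

namespace Dendroidal

/-! ## Symmetric coloured operads -/

/-- A symmetric coloured operad (in sets), in its coordinate-free form: the inputs of an operation
are labelled by an arbitrary finite set `I`, the symmetric group actions are replaced by relabelling
along bijections, and the composition plugs an operation into every input. -/
structure SymOperad where
  Colour : Type u
  Op : {I : Type} → [Finite I] → (I → Colour) → Colour → Type v
  one : (d : Colour) → Op (fun _ : Unit => d) d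
  relabel : {I J : Type} → [Finite I] → [Finite J] → {c : I → Colour} → {d : Colour} →
    (σ : J ≃ I) → Op c d → Op (fun j => c (σ j)) d
  comp : {I : Type} → [Finite I] → {J : I → Type} → [∀ i, Finite (J i)] → {c : I → Colour} →
    {c' : (i : I) → J i → Colour} → {d : Colour} →
    Op c d → ((i : I) → Op (c' i) (c i)) → Op (fun x : (Σ i, J i) => c' x.1 x.2) d
  relabel_refl : ∀ {I : Type} [Finite I] {c : I → Colour} {d : Colour} (p : Op c d),
    relabel (Equiv.refl I) p = p
  relabel_trans : ∀ {I J K : Type} [Finite I] [Finite J] [Finite K] {c : I → Colour} {d : Colour}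
    (σ : J ≃ I) (τ : K ≃ J) (p : Op c d),
    relabel τ (relabel σ p) = relabel (τ.trans σ) p
  comp_relabel_left : ∀ {I I' : Type} [Finite I] [Finite I'] {J : I → Type} [∀ i, Finite (J i)]
    {c : I → Colour} {c' : (i : I) → J i → Colour} {d : Colour} (σ : I' ≃ I)
    (p : Op c d) (q : (i : I) → Op (c' i) (c i)),
    comp (relabel σ p) (fun i' => q (σ i')) =
      relabel (Equiv.sigmaCongrLeft (β := J) σ) (comp p q)
  comp_relabel_right : ∀ {I : Type} [Finite I] {J J' : I → Type} [∀ i, Finite (J i)]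
    [∀ i, Finite (J' i)] {c : I → Colour} {c' : (i : I) → J i → Colour} {d : Colour}
    (σ : (i : I) → J' i ≃ J i) (p : Op c d) (q : (i : I) → Op (c' i) (c i)),
    comp p (fun i => relabel (σ i) (q i)) = relabel (Equiv.sigmaCongrRight σ) (comp p q)
  one_comp : ∀ {I : Type} [Finite I] {c : I → Colour} {d : Colour} (p : Op c d),
    comp (one d) (fun _ => p) = relabel (Equiv.uniqueSigma fun _ : Unit => I) p
  comp_one : ∀ {I : Type} [Finite I] {c : I → Colour} {d : Colour} (p : Op c d),
    comp p (fun i => one (c i)) = relabel (Equiv.sigmaUnique I fun _ => Unit) p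
  assoc : ∀ {I : Type} [Finite I] {J : I → Type} [∀ i, Finite (J i)]
    {K : (i : I) → J i → Type} [∀ i j, Finite (K i j)] {c : I → Colour}
    {c' : (i : I) → J i → Colour} {c'' : (i : I) → (j : J i) → K i j → Colour} {d : Colour}
    (p : Op c d) (q : (i : I) → Op (c' i) (c i)) (r : (i : I) → (j : J i) → Op (c'' i j) (c' i j)),
    comp (comp p q) (fun x => r x.1 x.2) =
      relabel (Equiv.sigmaAssoc K) (comp p (fun i => comp (q i) (r i)))

namespace SymOperad

/-- A map of symmetric coloured operads. -/
@[ext]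
structure Hom (P Q : SymOperad.{u, v}) where
  colour : P.Colour → Q.Colour
  op : {I : Type} → [Finite I] → {c : I → P.Colour} → {d : P.Colour} →
    P.Op c d → Q.Op (fun i => colour (c i)) (colour d)
  map_one : ∀ d, op (P.one d) = Q.one (colour d)
  map_relabel : ∀ {I J : Type} [Finite I] [Finite J] {c : I → P.Colour} {d : P.Colour}
    (σ : J ≃ I) (p : P.Op c d), op (P.relabel σ p) = Q.relabel σ (op p)
  map_comp : ∀ {I : Type} [Finite I] {J : I → Type} [∀ i, Finite (J i)] {c : I → P.Colour}
    {c' : (i : I) → J i → P.Colour} {d : P.Colour} (p : P.Op c d)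
    (q : (i : I) → P.Op (c' i) (c i)), op (P.comp p q) = Q.comp (op p) (fun i => op (q i))

instance : Category SymOperad.{u, v} where
  Hom := Hom
  id P := ⟨id, id, fun _ => rfl, fun _ _ => rfl, fun _ _ => rfl⟩
  comp f g := ⟨g.colour ∘ f.colour, fun p => g.op (f.op p),
    fun d => by rw [f.map_one, g.map_one]; rfl,
    fun σ p => by rw [f.map_relabel, g.map_relabel],
    fun p q => by rw [f.map_comp, g.map_comp]⟩

end SymOperad

/-! ## Non-planar rooted trees -/

/-- A non-planar rooted tree. Edges are directed towards the root; `top e` is the vertex at the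
upper end (source) of `e`, if there is one, and `bot e` the vertex at its lower end (target), if
there is one. Every vertex `x` has exactly one outgoing edge `out x` (so that there are finitely
many vertices), the root is the only edge without lower vertex, and going down from any edge one
arrives at the root. -/
structure RTree where
  Edge : Type
  Vertex : Type
  [fintypeEdge : Fintype Edge]
  top : Edge → Option Vertex
  bot : Edge → Option Vertex
  out : Vertex → Edge
  root : Edge
  top_eq_some : ∀ e x, top e = some x ↔ out x = e
  bot_eq_none : ∀ e, bot e = none ↔ e = root
  reach : ∀ e, Relation.ReflTransGen (fun a b => ∃ x, bot a = some x ∧ out x = b) e root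

namespace RTree

attribute [instance] fintypeEdge

variable (T : RTree)

/-- The inputs of a vertex: its incoming edges. -/
abbrev Inputs (x : T.Vertex) : Type := {e : T.Edge // T.bot e = some x}

/-! ### The free symmetric coloured operad on the vertices of a tree -/

/-- Formal operadic expressions in the vertices of `T`. -/
inductive Expr : {I : Type} → [Finite I] → (I → T.Edge) → T.Edge → Type 1
  | one (d : T.Edge) : Expr (fun _ : Unit => d) d
  | vertex (x : T.Vertex) : Expr (fun e : T.Inputs x => e.1) (T.out x)
  | relabel {I J : Type} [Finite I] [Finite J] {c : I → T.Edge} {d : T.Edge}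
      (σ : J ≃ I) (p : Expr c d) : Expr (fun j => c (σ j)) d
  | comp {I : Type} [Finite I] {J : I → Type} [∀ i, Finite (J i)] {c : I → T.Edge}
      {c' : (i : I) → J i → T.Edge} {d : T.Edge}
      (p : Expr c d) (q : (i : I) → Expr (c' i) (c i)) : Expr (fun x : (Σ i, J i) => c' x.1 x.2) d

variable {T} in
/-- The congruence on expressions generated by the axioms of a symmetric coloured operad. -/
inductive Rel : {I : Type} → [Finite I] → {c : I → T.Edge} → {d : T.Edge} →
    T.Expr c d → T.Expr c d → Prop
  | refl {I : Type} [Finite I] {c : I → T.Edge} {d : T.Edge} (p : T.Expr c d) : Rel p p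
  | symm {I : Type} [Finite I] {c : I → T.Edge} {d : T.Edge} {p q : T.Expr c d} :
      Rel p q → Rel q p
  | trans {I : Type} [Finite I] {c : I → T.Edge} {d : T.Edge} {p q r : T.Expr c d} :
      Rel p q → Rel q r → Rel p r
  | relabel {I J : Type} [Finite I] [Finite J] {c : I → T.Edge} {d : T.Edge}
      (σ : J ≃ I) {p p' : T.Expr c d} : Rel p p' → Rel (p.relabel σ) (p'.relabel σ)
  | comp {I : Type} [Finite I] {J : I → Type} [∀ i, Finite (J i)] {c : I → T.Edge}
      {c' : (i : I) → J i → T.Edge} {d : T.Edge} {p p' : T.Expr c d}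
      {q q' : (i : I) → T.Expr (c' i) (c i)} :
      Rel p p' → (∀ i, Rel (q i) (q' i)) → Rel (p.comp q) (p'.comp q')
  | relabel_refl {I : Type} [Finite I] {c : I → T.Edge} {d : T.Edge} (p : T.Expr c d) :
      Rel (p.relabel (Equiv.refl I)) p
  | relabel_trans {I J K : Type} [Finite I] [Finite J] [Finite K] {c : I → T.Edge} {d : T.Edge}
      (σ : J ≃ I) (τ : K ≃ J) (p : T.Expr c d) :
      Rel ((p.relabel σ).relabel τ) (p.relabel (τ.trans σ))
  | comp_relabel_left {I I' : Type} [Finite I] [Finite I'] {J : I → Type} [∀ i, Finite (J i)]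
      {c : I → T.Edge} {c' : (i : I) → J i → T.Edge} {d : T.Edge} (σ : I' ≃ I)
      (p : T.Expr c d) (q : (i : I) → T.Expr (c' i) (c i)) :
      Rel ((p.relabel σ).comp (fun i' => q (σ i')))
        ((p.comp q).relabel (Equiv.sigmaCongrLeft (β := J) σ))
  | comp_relabel_right {I : Type} [Finite I] {J J' : I → Type} [∀ i, Finite (J i)]
      [∀ i, Finite (J' i)] {c : I → T.Edge} {c' : (i : I) → J i → T.Edge} {d : T.Edge}
      (σ : (i : I) → J' i ≃ J i) (p : T.Expr c d) (q : (i : I) → T.Expr (c' i) (c i)) :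
      Rel (p.comp (fun i => (q i).relabel (σ i))) ((p.comp q).relabel (Equiv.sigmaCongrRight σ))
  | one_comp {I : Type} [Finite I] {c : I → T.Edge} {d : T.Edge} (p : T.Expr c d) :
      Rel ((Expr.one d).comp (fun _ => p)) (p.relabel (Equiv.uniqueSigma fun _ : Unit => I))
  | comp_one {I : Type} [Finite I] {c : I → T.Edge} {d : T.Edge} (p : T.Expr c d) :
      Rel (p.comp (fun i => Expr.one (c i))) (p.relabel (Equiv.sigmaUnique I fun _ => Unit))
  | assoc {I : Type} [Finite I] {J : I → Type} [∀ i, Finite (J i)]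
      {K : (i : I) → J i → Type} [∀ i j, Finite (K i j)] {c : I → T.Edge}
      {c' : (i : I) → J i → T.Edge} {c'' : (i : I) → (j : J i) → K i j → T.Edge} {d : T.Edge}
      (p : T.Expr c d) (q : (i : I) → T.Expr (c' i) (c i))
      (r : (i : I) → (j : J i) → T.Expr (c'' i j) (c' i j)) :
      Rel ((p.comp q).comp (fun x => r x.1 x.2))
        ((p.comp (fun i => (q i).comp (r i))).relabel (Equiv.sigmaAssoc K))

instance exprSetoid {I : Type} [Finite I] (c : I → T.Edge) (d : T.Edge) : Setoid (T.Expr c d) :=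
  ⟨Rel, Rel.refl, Rel.symm, Rel.trans⟩

theorem rel_out {I : Type} [Finite I] {c : I → T.Edge} {d : T.Edge} (p : T.Expr c d) :
    Rel (Quotient.out (Quotient.mk (T.exprSetoid c d) p)) p :=
  Quotient.mk_out (s := T.exprSetoid c d) p

/-- The symmetric coloured operad `Ω[T]` generated by the tree `T`: its colours are the edges of
`T`, and it is freely generated by one operation for each vertex, from the incoming edges of the
vertex to its outgoing edge. -/
noncomputable def operad : SymOperad.{0, 1} where
  Colour := T.Edge
  Op c d := Quotient (T.exprSetoid c d)
  one d := Quotient.mk _ (Expr.one d)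
  relabel σ p := Quotient.mk _ (p.out.relabel σ)
  comp p q := Quotient.mk _ (p.out.comp fun i => (q i).out)
  relabel_refl p := by
    conv_rhs => rw [← Quotient.out_eq p]
    exact Quotient.sound (Rel.relabel_refl _)
  relabel_trans σ τ p := Quotient.sound
    ((Rel.relabel τ (T.rel_out _)).trans (Rel.relabel_trans σ τ _))
  comp_relabel_left σ p q := Quotient.sound
    (((Rel.comp (T.rel_out _) fun _ => Rel.refl _).trans (Rel.comp_relabel_left σ p.out fun i => (q i).out)).trans
      (Rel.relabel _ (T.rel_out _).symm))
  comp_relabel_right σ p q := Quotient.sound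
    (((Rel.comp (Rel.refl _) fun _ => T.rel_out _).trans (Rel.comp_relabel_right σ _ _)).trans
      (Rel.relabel _ (T.rel_out _).symm))
  one_comp p := Quotient.sound ((Rel.comp (T.rel_out _) fun _ => Rel.refl _).trans (Rel.one_comp _))
  comp_one p := Quotient.sound ((Rel.comp (Rel.refl _) fun _ => T.rel_out _).trans (Rel.comp_one _))
  assoc p q r := Quotient.sound
    (((Rel.comp (T.rel_out _) fun _ => Rel.refl _).trans
      (Rel.assoc p.out (fun i => (q i).out) fun i j => (r i j).out)).trans
      (Rel.relabel _ ((Rel.comp (Rel.refl _) fun _ => (T.rel_out _).symm).trans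
        (T.rel_out _).symm)))

/-- The category `Ω` of trees: a morphism `S ⟶ T` is a map of operads `Ω[S] ⟶ Ω[T]`. -/
noncomputable instance : Category RTree where
  Hom S T := S.operad ⟶ T.operad
  id T := 𝟙 T.operad
  comp f g := CategoryStruct.comp (obj := SymOperad.{0, 1}) f g

variable {T} in
/-- The effect of a morphism of `Ω` on edges. -/
def onEdges {S : RTree} (f : S ⟶ T) : S.Edge → T.Edge := SymOperad.Hom.colour f

/-! ### Morphisms out of the free operad -/

/-- The value of an expression in an operad. -/
noncomputable def eval (P : SymOperad.{0, 1}) (f : T.Edge → P.Colour)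
    (g : (x : T.Vertex) → P.Op (fun e : T.Inputs x => f e.1) (f (T.out x))) :
    {I : Type} → [Finite I] → {c : I → T.Edge} → {d : T.Edge} → T.Expr c d →
      P.Op (fun i => f (c i)) (f d)
  | _, _, _, _, .one d => P.one (f d)
  | _, _, _, _, .vertex x => g x
  | _, _, _, _, @Expr.relabel _ _ _ _ _ _ _ σ p => P.relabel σ (eval P f g p)
  | _, _, _, _, @Expr.comp _ _ _ _ _ _ _ _ p q => P.comp (eval P f g p) (fun i => eval P f g (q i))

theorem eval_rel (P : SymOperad.{0, 1}) (f : T.Edge → P.Colour)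
    (g : (x : T.Vertex) → P.Op (fun e : T.Inputs x => f e.1) (f (T.out x)))
    {I : Type} [Finite I] {c : I → T.Edge} {d : T.Edge} {p q : T.Expr c d} (h : Rel p q) :
    T.eval P f g p = T.eval P f g q := by
  induction h with
  | refl => rfl
  | symm _ ih => exact ih.symm
  | trans _ _ ih ih' => exact ih.trans ih'
  | relabel σ _ ih => simp only [eval, ih]
  | comp _ _ ih ih' => simp only [eval, ih, ih']
  | relabel_refl => exact P.relabel_refl _
  | relabel_trans => exact P.relabel_trans _ _ _
  | comp_relabel_left σ p q => exact P.comp_relabel_left σ _ (fun i => T.eval P f g (q i))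
  | comp_relabel_right => exact P.comp_relabel_right _ _ _
  | one_comp => exact P.one_comp _
  | comp_one => exact P.comp_one _
  | assoc p q r => exact P.assoc _ _ (fun i j => T.eval P f g (r i j))

/-- The map of operads out of `Ω[T]` with given values on edges and vertices. -/
noncomputable def lift (P : SymOperad.{0, 1}) (f : T.Edge → P.Colour)
    (g : (x : T.Vertex) → P.Op (fun e : T.Inputs x => f e.1) (f (T.out x))) : T.operad ⟶ P where
  colour := f
  op p := T.eval P f g (Quotient.out p)
  map_one _ := T.eval_rel P f g (T.rel_out _)
  map_relabel _ _ := T.eval_rel P f g (T.rel_out _)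
  map_comp _ _ := T.eval_rel P f g (T.rel_out _)

/-- A morphism of `Ω` from a map on edges such that every vertex of the source can be sent to
some operation of the target. (There is at most one choice for that operation.) -/
noncomputable def mkHom {S T : RTree} (f : S.Edge → T.Edge)
    (h : ∀ x, Nonempty (T.operad.Op (fun e : S.Inputs x => f e.1) (f (S.out x)))) : S ⟶ T :=
  S.lift T.operad f fun x => (h x).some

variable {T}

theorem op_congr {I K : Type} [Finite I] [Finite K] {c : I → T.Edge} {c' : K → T.Edge}
    {d d' : T.Edge} (σ : K ≃ I) (hc : ∀ k, c (σ k) = c' k) (hd : d = d')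
    (h : Nonempty (T.operad.Op c d)) : Nonempty (T.operad.Op c' d') := by
  obtain rfl : (fun k => c (σ k)) = c' := funext hc
  subst hd
  exact h.map (T.operad.relabel σ)

theorem op_vertex (x : T.Vertex) :
    Nonempty (T.operad.Op (fun e : T.Inputs x => e.1) (T.out x)) :=
  ⟨Quotient.mk _ (Expr.vertex x)⟩

theorem op_one {K : Type} [Finite K] [Unique K] {c : K → T.Edge} {d : T.Edge}
    (hc : ∀ k, c k = d) : Nonempty (T.operad.Op c d) :=
  op_congr (Equiv.ofUnique K Unit) (fun k => (hc k).symm) rfl ⟨T.operad.one d⟩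

theorem op_comp {I K : Type} [Finite I] [Finite K] {c : I → T.Edge} {c' : K → T.Edge}
    {d : T.Edge} (φ : K → I) (p : Nonempty (T.operad.Op c d))
    (q : ∀ i, Nonempty (T.operad.Op (fun k : {k // φ k = i} => c' k.1) (c i))) :
    Nonempty (T.operad.Op c' d) :=
  ⟨T.operad.relabel (Equiv.sigmaFiberEquiv φ).symm (T.operad.comp p.some fun i => (q i).some)⟩

theorem out_ne {e : T.Edge} {x : T.Vertex} (h : T.bot e = some x) : T.out x ≠ e := by
  intro h'
  have key : ∀ b, Relation.ReflTransGen (fun a b => ∃ x, T.bot a = some x ∧ T.out x = b) e b →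
      b = e := by
    intro b hb
    induction hb with
    | refl => rfl
    | tail _ hs ih =>
      obtain ⟨y, hy, rfl⟩ := hs
      rw [ih, h, Option.some.injEq] at hy
      rw [← hy, h']
  have h1 := key _ (T.reach e)
  rw [(T.bot_eq_none e).2 h1.symm] at h
  cases h

theorem top_out (x : T.Vertex) : T.top (T.out x) = some x := (T.top_eq_some _ _).2 rfl

theorem out_inj {x y : T.Vertex} (h : T.out x = T.out y) : x = y := by
  have := T.top_out x
  rw [h, T.top_out, Option.some.injEq] at this
  exact this.symm

open Classical in
/-- Forget the vertex `x`. -/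
noncomputable def forget {V : Type} (x : V) (o : Option V) : Option {y // y ≠ x} :=
  o.bind fun y => if h : y ≠ x then some ⟨y, h⟩ else none

theorem forget_eq_some {V : Type} {x : V} {o : Option V} {y : {y // y ≠ x}} :
    forget x o = some y ↔ o = some y.1 := by
  obtain ⟨y, hy⟩ := y
  cases o with
  | none => simp [forget]
  | some z =>
    by_cases hz : z = x
    · subst hz
      simpa [forget] using fun h => hy h.symm
    · simp [forget, hz]

theorem forget_eq_none {V : Type} {x : V} {o : Option V} :
    forget x o = none ↔ o = none ∨ o = some x := by
  cases o with
  | none => simp [forget]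
  | some z => by_cases hz : z = x <;> simp [forget, hz]

/-! ### The unit tree and the inclusions of edges -/

/-- The unit tree: one edge and no vertex. -/
def unitTree : RTree where
  Edge := Unit
  Vertex := Empty
  top _ := none
  bot _ := none
  out := Empty.elim
  root := ()
  top_eq_some _ x := x.elim
  bot_eq_none _ := by simp
  reach _ := .refl

/-- The morphism from the unit tree to `T` given by an edge of `T`. For a corolla `T` (a tree with
exactly one vertex) these are the outer faces. -/
noncomputable def edgeMap (e : T.Edge) : unitTree ⟶ T := mkHom (fun _ => e) fun x => x.elim

/-! ### Inner faces -/

section Inner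

variable {e : T.Edge} {x y : T.Vertex}

open Classical in
/-- The tree `T/e` obtained by contracting the inner edge `e` from the vertex `x` to the vertex `y`;
the vertex that results from `x` and `y` is called `y` again. -/
noncomputable def contract (hx : T.top e = some x) (hy : T.bot e = some y) : RTree where
  Edge := {a : T.Edge // a ≠ e}
  Vertex := {z : T.Vertex // z ≠ x}
  fintypeEdge := Fintype.ofFinite _
  top a := forget x (T.top a.1)
  bot a := if T.bot a.1 = some x then
      some ⟨y, fun h => T.out_ne hy (h ▸ (T.top_eq_some _ _).1 hx)⟩
    else forget x (T.bot a.1)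
  out z := ⟨T.out z.1, fun h => z.2 (T.out_inj (h.trans ((T.top_eq_some _ _).1 hx).symm))⟩
  root := ⟨T.root, fun h => by
    rw [(T.bot_eq_none e).2 h.symm] at hy
    cases hy⟩
  top_eq_some a z := by
    rw [forget_eq_some, T.top_eq_some, Subtype.ext_iff]
  bot_eq_none a := by
    rw [Subtype.ext_iff, ← T.bot_eq_none]
    split_ifs with h
    · simp [h]
    · rw [forget_eq_none]
      exact ⟨fun h' => h'.resolve_right h, Or.inl⟩
  reach := by
    have hex := (T.top_eq_some _ _).1 hx
    have hyx : y ≠ x := fun h => T.out_ne hy (h ▸ hex)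
    have hne : ∀ z, z ≠ x → T.out z ≠ e := fun z hz h => hz (T.out_inj (h.trans hex.symm))
    have hroot : T.root ≠ e := fun h => by
      rw [(T.bot_eq_none e).2 h.symm] at hy
      cases hy
    have hmain : ∀ a, (∀ ha : a ≠ e, Relation.ReflTransGen
        (fun a b : {a : T.Edge // a ≠ e} => ∃ z : {z : T.Vertex // z ≠ x},
          (if T.bot a.1 = some x then some ⟨y, hyx⟩ else forget x (T.bot a.1)) = some z ∧
          (⟨T.out z.1, hne z.1 z.2⟩ : {a : T.Edge // a ≠ e}) = b) ⟨a, ha⟩ ⟨T.root, hroot⟩) ∧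
        (a = e → Relation.ReflTransGen
        (fun a b : {a : T.Edge // a ≠ e} => ∃ z : {z : T.Vertex // z ≠ x},
          (if T.bot a.1 = some x then some ⟨y, hyx⟩ else forget x (T.bot a.1)) = some z ∧
          (⟨T.out z.1, hne z.1 z.2⟩ : {a : T.Edge // a ≠ e}) = b)
          ⟨T.out y, hne y hyx⟩ ⟨T.root, hroot⟩) := by
      intro a
      induction T.reach a using Relation.ReflTransGen.head_induction_on with
      | refl => exact ⟨fun _ => .refl, fun h => (hroot h).elim⟩
      | head hs _ ih =>
        obtain ⟨z, hz, rfl⟩ := hs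
        refine ⟨fun ha => ?_, fun ha => ?_⟩
        · by_cases hzx : z = x
          · subst hzx
            exact .head ⟨⟨y, hyx⟩, by simp [hz], rfl⟩ (ih.2 hex)
          · refine .head ⟨⟨z, hzx⟩, ?_, rfl⟩ (ih.1 (hne z hzx))
            rw [if_neg (by simpa [hz] using hzx), forget_eq_some, hz]
        · subst ha
          rw [hy, Option.some.injEq] at hz
          subst hz
          exact ih.1 _
    exact fun a => (hmain a.1).1 a.2

open Classical in
theorem bot_contract {hx : T.top e = some x} {hy : T.bot e = some y}
    {a : (contract hx hy).Edge} {z : (contract hx hy).Vertex} :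
    (contract hx hy).bot a = some z ↔
      T.bot a.1 = some z.1 ∨ (T.bot a.1 = some x ∧ z.1 = y) := by
  suffices h0 : ∀ (a : {a : T.Edge // a ≠ e}) (z : {z : T.Vertex // z ≠ x}),
      (if T.bot a.1 = some x then
        some ⟨y, fun h => T.out_ne hy (h ▸ (T.top_eq_some _ _).1 hx)⟩
      else forget x (T.bot a.1)) = some z ↔ T.bot a.1 = some z.1 ∨ (T.bot a.1 = some x ∧ z.1 = y) from
    h0 a z
  intro a z
  split_ifs with h
  · rw [h, Option.some.injEq, Option.some.injEq, Subtype.ext_iff]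
    have := z.2
    constructor
    · exact fun h => Or.inr ⟨rfl, h.symm⟩
    · rintro (h | h)
      · exact (this h.symm).elim
      · exact h.2.symm
  · rw [forget_eq_some]
    simp [h]

open Classical in
/-- The inner face map `T/e ⟶ T`; it is the inclusion on edges. -/
noncomputable def innerFace (hx : T.top e = some x) (hy : T.bot e = some y) :
    contract hx hy ⟶ T := mkHom Subtype.val fun z => by
  have hex := (T.top_eq_some _ _).1 hx
  by_cases hz : z.1 = y
  · refine op_comp (c := fun a : T.Inputs y => a.1)
      (fun a => if h : T.bot a.1.1 = some x then ⟨e, hy⟩ else ⟨a.1.1, by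
        rcases bot_contract.1 a.2 with h' | h'
        · rw [h', hz]
        · exact (h h'.1).elim⟩) ?_ ?_
    · exact op_congr (Equiv.refl _) (fun _ => rfl) (congrArg T.out hz.symm) (T.op_vertex y)
    · rintro ⟨b, hb⟩
      by_cases hbe : b = e
      · subst hbe
        refine op_congr (Equiv.ofBijective (fun k => (⟨k.1.1.1, ?_⟩ : T.Inputs x)) ⟨?_, ?_⟩)
          (fun _ => rfl) hex (T.op_vertex x)
        · by_contra h
          have := k.2
          rw [dif_neg h] at this
          exact k.1.1.2 (congrArg Subtype.val this)
        · intro k k' hk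
          exact Subtype.ext (Subtype.ext (Subtype.ext (congrArg (fun a : T.Inputs x => a.1) hk)))
        · rintro ⟨a, ha⟩
          refine ⟨⟨⟨⟨a, ?_⟩, bot_contract.2 (Or.inr ⟨ha, hz⟩)⟩, dif_pos ha⟩, rfl⟩
          rintro rfl
          exact T.out_ne ha hex
      · have hb' : T.bot b ≠ some x := fun h => by
          rw [hb, Option.some.injEq] at h
          subst h
          exact T.out_ne hy hex
        have hval : ∀ k : (contract hx hy).Inputs z, (if h : T.bot k.1.1 = some x then
            (⟨e, hy⟩ : T.Inputs y) else ⟨k.1.1, by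
              rcases bot_contract.1 k.2 with h' | h'
              · rw [h', hz]
              · exact (h h'.1).elim⟩) = ⟨b, hb⟩ → k.1.1 = b := by
          intro k hk
          split_ifs at hk with h
          · exact (hbe (Subtype.ext_iff.1 hk).symm).elim
          · exact congrArg Subtype.val hk
        refine @op_one T _ _ ⟨⟨⟨⟨⟨b, hbe⟩, bot_contract.2 (Or.inl (by rw [hb, hz]))⟩,
          dif_neg hb'⟩⟩, fun k => ?_⟩ _ _ fun k => hval k.1 k.2
        exact Subtype.ext (Subtype.ext (Subtype.ext (hval k.1 k.2)))
  · refine op_congr (Equiv.ofBijective (fun k => (⟨k.1.1, ?_⟩ : T.Inputs z.1)) ⟨?_, ?_⟩)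
      (fun _ => rfl) rfl (T.op_vertex z.1)
    · exact (bot_contract.1 k.2).resolve_right fun h => hz h.2
    · intro k k' hk
      exact Subtype.ext (Subtype.ext (congrArg (fun a : T.Inputs z.1 => a.1) hk))
    · rintro ⟨a, ha⟩
      refine ⟨⟨⟨a, ?_⟩, bot_contract.2 (Or.inl ha)⟩, rfl⟩
      rintro rfl
      rw [hy, Option.some.injEq] at ha
      exact hz ha.symm

end Inner

/-! ### Outer faces -/

section Outer

/-- An inner edge: it is connected to two vertices. -/
def IsInner (e : T.Edge) : Prop := T.top e ≠ none ∧ T.bot e ≠ none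

/-- The edge `e` is attached to the vertex `x`. -/
def IsAttached (e : T.Edge) (x : T.Vertex) : Prop := T.top e = some x ∨ T.bot e = some x

variable {x : T.Vertex}

open Classical in
/-- The tree `T/x` obtained by deleting a vertex `x` to which exactly one inner edge is attached,
together with all outer edges attached to it. (If the root is one of them, then the inner edge
attached to `x` becomes the root.) -/
noncomputable def prune (hx : ∃! a, T.IsInner a ∧ T.IsAttached a x) : RTree where
  Edge := {a : T.Edge // T.IsAttached a x → T.IsInner a}
  Vertex := {z : T.Vertex // z ≠ x}
  fintypeEdge := Fintype.ofFinite _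
  top a := forget x (T.top a.1)
  bot a := forget x (T.bot a.1)
  out z := ⟨T.out z.1, fun h => ⟨by simp [T.top_out], by
    rcases h with h | h
    · rw [T.top_out, Option.some.injEq] at h
      exact (z.2 h).elim
    · simp [h]⟩⟩
  root := if h : T.out x = T.root then ⟨hx.choose, fun _ => hx.choose_spec.1.1⟩ else
    ⟨T.root, by
      rintro (h' | h')
      · exact (h ((T.top_eq_some _ _).1 h')).elim
      · rw [(T.bot_eq_none _).2 rfl] at h'
        cases h'⟩
  top_eq_some a z := by
    rw [forget_eq_some, T.top_eq_some, Subtype.ext_iff]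
  bot_eq_none a := by
    obtain ⟨a, ha⟩ := a
    rw [forget_eq_none, T.bot_eq_none]
    have hun : ∀ b, T.IsInner b → T.IsAttached b x → b = hx.choose :=
      fun b h h' => hx.choose_spec.2 b ⟨h, h'⟩
    have hin := hx.choose_spec.1
    split_ifs with h
    · rw [Subtype.ext_iff]
      constructor
      · rintro (h' | h')
        · have h1 : T.IsAttached a x := Or.inl ((T.top_eq_some _ _).2 (h.trans h'.symm))
          exact ((ha h1).2 ((T.bot_eq_none _).2 h')).elim
        · exact hun _ (ha (Or.inr h')) (Or.inr h')
      · intro h'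
        dsimp only at h'
        rw [← h'] at hin
        rcases hin.2 with h2 | h2
        · have := (T.top_eq_some _ _).1 h2
          exact Or.inl (this.symm.trans h)
        · exact Or.inr h2
    · rw [Subtype.ext_iff]
      refine ⟨fun h' => h'.resolve_right fun h2 => ?_, Or.inl⟩
      have h3 := hun _ (ha (Or.inr h2)) (Or.inr h2)
      have h4 := hun (T.out x) ⟨by simp [T.top_out], fun h' => h ((T.bot_eq_none _).1 h')⟩
        (Or.inl (T.top_out x))
      exact T.out_ne h2 (h4.trans h3.symm)
  reach := by
    have hun : ∀ b, T.IsInner b → T.IsAttached b x → b = hx.choose :=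
      fun b h h' => hx.choose_spec.2 b ⟨h, h'⟩
    have hkeep : ∀ z, z ≠ x → T.IsAttached (T.out z) x → T.IsInner (T.out z) := by
      intro z hz h
      refine ⟨by simp [T.top_out], ?_⟩
      rcases h with h | h
      · rw [T.top_out, Option.some.injEq] at h
        exact (hz h).elim
      · simp [h]
    intro a
    generalize hr : (if h : T.out x = T.root then
      (⟨hx.choose, fun _ => hx.choose_spec.1.1⟩ : {a : T.Edge // T.IsAttached a x → T.IsInner a})
      else ⟨T.root, by
        rintro (h' | h')
        · exact (h ((T.top_eq_some _ _).1 h')).elim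
        · rw [(T.bot_eq_none _).2 rfl] at h'
          cases h'⟩) = r
    obtain ⟨a, ha⟩ := a
    induction T.reach a using Relation.ReflTransGen.head_induction_on with
    | refl =>
      split_ifs at hr with h
      · exact ((ha (Or.inl ((T.top_eq_some _ _).2 h))).2 ((T.bot_eq_none _).2 rfl)).elim
      · subst hr
        exact .refl
    | head hs _ ih =>
      obtain ⟨z, hz, rfl⟩ := hs
      by_cases hzx : z = x
      · subst hzx
        have h3 := hun _ (ha (Or.inr hz)) (Or.inr hz)
        split_ifs at hr with h
        · subst hr
          simp only [h3]
          exact .refl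
        · have h4 := hun (T.out z) ⟨by simp [T.top_out], fun h' => h ((T.bot_eq_none _).1 h')⟩
            (Or.inl (T.top_out z))
          exact (T.out_ne hz (h4.trans h3.symm)).elim
      · exact .head ⟨⟨z, hzx⟩, forget_eq_some.2 hz, rfl⟩ (ih (hkeep z hzx))

/-- The outer face map `T/x ⟶ T`; it is the inclusion on edges. -/
noncomputable def outerFace (hx : ∃! a, T.IsInner a ∧ T.IsAttached a x) : prune hx ⟶ T :=
  mkHom Subtype.val fun z => by
    refine op_congr (Equiv.ofBijective
      (fun k => (⟨k.1.1, forget_eq_some.1 k.2⟩ : T.Inputs z.1)) ⟨?_, ?_⟩)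
      (fun _ => rfl) rfl (T.op_vertex z.1)
    · intro k k' hk
      exact Subtype.ext (Subtype.ext (congrArg (fun a : T.Inputs z.1 => a.1) hk))
    · rintro ⟨a, ha⟩
      refine ⟨⟨⟨a, ?_⟩, forget_eq_some.2 ha⟩, rfl⟩
      rintro (h | h)
      · exact ⟨by simp [h], by simp [ha]⟩
      · rw [ha, Option.some.injEq] at h
        exact (z.2 h).elim

end Outer

/-! ### Degeneracies -/

section Degeneracy

variable {x : T.Vertex} {e : T.Edge}

open Classical in
/-- The tree `T∖x` obtained by deleting a vertex `x` with exactly one incoming edge `e`, and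
merging `e` and `T.out x` into one edge, which is called `T.out x` again. -/
noncomputable def merge (he : T.bot e = some x) (hu : ∀ a, T.bot a = some x → a = e) : RTree where
  Edge := {a : T.Edge // a ≠ e}
  Vertex := {z : T.Vertex // z ≠ x}
  fintypeEdge := Fintype.ofFinite _
  top a := if a.1 = T.out x then forget x (T.top e) else forget x (T.top a.1)
  bot a := forget x (T.bot a.1)
  out z := if h : T.out z.1 = e then ⟨T.out x, T.out_ne he⟩ else ⟨T.out z.1, h⟩
  root := ⟨T.root, fun h => by
    rw [(T.bot_eq_none e).2 h.symm] at he
    cases he⟩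
  top_eq_some a z := by
    obtain ⟨a, ha⟩ := a
    have hz : T.out z.1 ≠ T.out x := fun h => z.2 (T.out_inj h)
    dsimp only
    split_ifs with h h' h'
    · rw [forget_eq_some, T.top_eq_some]
      simp [h, h']
    · rw [forget_eq_some, T.top_eq_some, Subtype.ext_iff]
      refine ⟨fun h2 => (h' h2).elim, fun h2 => ?_⟩
      exact (hz (h2.trans h)).elim
    · rw [forget_eq_some, T.top_eq_some, Subtype.ext_iff]
      refine ⟨fun h2 => (ha (h2.symm.trans h')).elim, fun h2 => (h h2.symm).elim⟩
    · rw [forget_eq_some, T.top_eq_some, Subtype.ext_iff]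
  bot_eq_none a := by
    rw [forget_eq_none, T.bot_eq_none, Subtype.ext_iff]
    exact ⟨fun h => h.resolve_right fun h' => a.2 (hu _ h'), Or.inl⟩
  reach := by
    have hroot : T.root ≠ e := fun h => by
      rw [(T.bot_eq_none e).2 h.symm] at he
      cases he
    have hmain : ∀ a, Relation.ReflTransGen
        (fun a b : {a : T.Edge // a ≠ e} => ∃ z : {z : T.Vertex // z ≠ x},
          forget x (T.bot a.1) = some z ∧
          (if h : T.out z.1 = e then ⟨T.out x, T.out_ne he⟩ else ⟨T.out z.1, h⟩) = b)
        (if h : a = e then ⟨T.out x, T.out_ne he⟩ else ⟨a, h⟩) ⟨T.root, hroot⟩ := by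
      intro a
      induction T.reach a using Relation.ReflTransGen.head_induction_on with
      | refl =>
        rw [dif_neg hroot]
      | @head a _ hs _ ih =>
        obtain ⟨z, hz, rfl⟩ := hs
        by_cases hae : a = e
        · subst hae
          rw [he, Option.some.injEq] at hz
          subst hz
          rw [dif_neg (T.out_ne he)] at ih
          rwa [dif_pos rfl]
        · rw [dif_neg hae]
          have hzx : z ≠ x := by
            rintro rfl
            exact hae (hu _ hz)
          exact .head ⟨⟨z, hzx⟩, forget_eq_some.2 hz, rfl⟩ ih
    intro a
    have := hmain a.1
    rwa [dif_neg a.2] at this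

open Classical in
/-- The degeneracy map `T ⟶ T∖x`; on edges, it sends both `e` and `T.out x` to the merged edge and
every other edge to itself. -/
noncomputable def degeneracy (he : T.bot e = some x) (hu : ∀ a, T.bot a = some x → a = e) :
    T ⟶ merge he hu :=
  mkHom (fun a => if h : a = e then ⟨T.out x, T.out_ne he⟩ else ⟨a, h⟩) fun z => by
    by_cases hz : z = x
    · subst hz
      refine @op_one _ _ _ ⟨⟨⟨e, he⟩⟩, fun k => Subtype.ext (hu _ k.2)⟩ _ _ fun k => ?_
      exact (dif_pos (hu _ k.2)).trans (dif_neg (T.out_ne he)).symm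
    · have hne : ∀ a, T.bot a = some z → a ≠ e := by
        rintro a ha rfl
        rw [he, Option.some.injEq] at ha
        exact hz ha.symm
      refine op_congr (Equiv.ofBijective (fun k => (⟨⟨k.1, hne _ k.2⟩, forget_eq_some.2 k.2⟩ :
        (merge he hu).Inputs ⟨z, hz⟩)) ⟨?_, ?_⟩) (fun k => ?_) rfl
        (op_vertex (T := merge he hu) ⟨z, hz⟩)
      · intro k k' hk
        exact Subtype.ext (congrArg (fun a : (merge he hu).Inputs ⟨z, hz⟩ => a.1.1) hk)
      · rintro ⟨⟨a, ha⟩, h⟩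
        exact ⟨⟨a, forget_eq_some.1 h⟩, rfl⟩
      · exact (dif_neg (hne _ k.2)).symm

end Degeneracy

end RTree

/-! ## The C*-algebra of a graph -/

/-- A directed graph with finitely many edges; `src e` and `rng e` are the source and the range of
the edge `e`. -/
structure DGraph where
  Vert : Type
  Edge : Type
  [fintypeEdge : Fintype Edge]
  src : Edge → Vert
  rng : Edge → Vert

attribute [instance] DGraph.fintypeEdge

/-- A path is a sequence `e₁ e₂ ⋯ eₙ` of edges with `src eᵢ = rng eᵢ₊₁`. -/
def DGraph.IsPath (G : DGraph) (μ : List G.Edge) : Prop :=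
  μ.IsChain fun e f => G.src e = G.rng f

/-- The relations between the generators `q e`: they are positive, they sum up to `1`, and a product
of generators vanishes unless all its factors belong to edges of a common path. -/
structure DGraph.Relations (G : DGraph) {A : Type u} [CStarAlgebra A] (q : G.Edge → A) : Prop where
  pos : ∀ e, ∃ b : A, q e = star b * b
  sum_eq_one : ∑ e, q e = 1
  prod_eq_zero : ∀ l : List G.Edge, (¬ ∃ μ, G.IsPath μ ∧ ∀ e ∈ l, e ∈ μ) → (l.map q).prod = 0

/-- `A` is the universal unital C*-algebra generated by the elements `q e` subject to the
relations. -/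
structure DGraph.IsUniversal (G : DGraph) {A : Type u} [CStarAlgebra A] (q : G.Edge → A) :
    Prop where
  relations : G.Relations q
  existsUnique : ∀ (B : Type u) [CStarAlgebra B] (p : G.Edge → B), G.Relations p →
    ∃! φ : A →⋆ₐ[ℂ] B, ∀ e, φ (q e) = p e

/-- The vertices of the modified tree: those of the tree, one new vertex at the tip of every leaf,
and one at the bottom of the root. -/
inductive RTree.ModVertex (T : RTree)
  | vertex (x : T.Vertex)
  | tip (e : T.Edge) (he : T.top e = none)
  | base

/-- The modified tree, as a graph. -/
abbrev RTree.modified (T : RTree) : DGraph where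
  Vert := T.ModVertex
  Edge := T.Edge
  src e := match h : T.top e with
    | some x => .vertex x
    | none => .tip e h
  rng e := match T.bot e with
    | some x => .vertex x
    | none => .base

/-! ## The category of nonzero separable unital C*-algebras -/

/-- Nonzero separable unital C*-algebras. -/
structure SCUn where
  carrier : Type u
  [cstarAlgebra : CStarAlgebra carrier]
  [nontrivial : Nontrivial carrier]
  [separableSpace : TopologicalSpace.SeparableSpace carrier]

namespace SCUn

instance : CoeSort SCUn.{u} (Type u) := ⟨carrier⟩

attribute [instance] cstarAlgebra nontrivial separableSpace

/-- Morphisms are the unit preserving *-homomorphisms. -/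
@[ext]
structure Hom (A B : SCUn.{u}) where
  hom : A →⋆ₐ[ℂ] B

instance : Category SCUn.{u} where
  Hom := Hom
  id A := ⟨StarAlgHom.id ℂ A⟩
  comp f g := ⟨g.hom.comp f.hom⟩

end SCUn

end Dendroidal

/-!
The universal algebra `D(T)` exists for every finite graph. The generators are positive and sum up
to `1`, so they have norm at most `1` in every representation of the relations
(`DGraph.Relations.norm_le_one`), and one may take the product of "all" representations and the
closed star subalgebra generated by the tautological family in it. To get a small product, one
representation is chosen for each norm that representations induce on noncommutative polynomials in
the generators (`DGraph.RepNorm`). Every other representation `p` is dominated in norm by that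
product, and the closure of the pairs (polynomial in the generators, same polynomial in `p`) is
then the graph of the required `*`-homomorphism (`DGraph.exists_starAlgHom_of_norm_le`). As the
generators are finitely many self-adjoint elements, the algebra is separable. For a tree it is
nonzero, because for each edge there is a representation in which the generator of that edge is `1`
and all other generators are `0` (`RTree.relations_single`).

A morphism of trees `τ : S ⟶ T` has to be sent to the map given by
`q_e ↦ ∑_{f : τ(f) = e} q_f`. These sums are positive with total sum `1`; a product of them expands
into products of generators of `D(S)`, and these vanish as soon as `τ` sends edges of a common path
to edges of a common path (`DGraph.Relations.pushforward`). Paths in the modified tree run up the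
tree, so this amounts to: if `e` is an input of a vertex `x`, then `τ(e)` lies above `τ(out x)`. Now
`τ(x)` is an operation of `Ω[T]` from the images of the inputs of `x` to `τ(out x)`, and the inputs
of any operation of `Ω[T]` lie above its output, by induction on the operadic expression
(`RTree.Expr.above`). Functoriality and the formulas for faces, degeneracies and isomorphisms are
obtained by comparing values on the generators.
-/

namespace Dendroidal

open scoped ENNReal

/-! ### Star subalgebras generated by finitely many self-adjoint elements -/

section Generated

variable {E : Type} {A : Type u} [CStarAlgebra A]

/-- For self-adjoint generators, the generated `*`-algebra consists of the noncommutative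
polynomials in them. -/
theorem coe_adjoin_range_eq_range_lift {p : E → A} (hp : ∀ e, IsSelfAdjoint (p e)) :
    (StarAlgebra.adjoin ℂ (Set.range p) : Set A) = Set.range (FreeAlgebra.lift ℂ p) := by
  have hs : star (Set.range p) = Set.range p := by
    ext a
    constructor
    · rintro ⟨e, he⟩
      exact ⟨e, by rw [← star_star a, ← he, (hp e).star_eq]⟩
    · rintro ⟨e, rfl⟩
      exact ⟨e, (hp e).star_eq.symm⟩
  have h := StarAlgebra.adjoin_toSubalgebra ℂ (Set.range p)
  rw [hs, Set.union_self, Algebra.adjoin_range_eq_range_freeAlgebra_lift] at h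
  exact congrArg (fun S : Subalgebra ℂ A => (S : Set A)) h

theorem isSeparable_topologicalClosure_adjoin [Finite E] {p : E → A}
    (hp : ∀ e, IsSelfAdjoint (p e)) :
    TopologicalSpace.IsSeparable
      ((StarAlgebra.adjoin ℂ (Set.range p)).topologicalClosure : Set A) := by
  rw [StarSubalgebra.topologicalClosure_coe]
  refine TopologicalSpace.IsSeparable.closure ?_
  rw [coe_adjoin_range_eq_range_lift hp, ← AlgHom.coe_range,
    ← Algebra.adjoin_range_eq_range_freeAlgebra_lift, ← Subalgebra.coe_toSubmodule,
    Algebra.adjoin_eq_span]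
  refine TopologicalSpace.IsSeparable.span (Set.Countable.isSeparable ?_)
  have : Countable (FreeMonoid E) := inferInstanceAs (Countable (List E))
  rw [← FreeMonoid.mrange_lift, MonoidHom.coe_mrange]
  exact Set.countable_range _

/-- A closed star subalgebra contains a square root of each of its elements that is positive in the
ambient algebra. -/
theorem exists_mem_eq_star_mul_self (S : StarSubalgebra ℂ A) [IsClosed (S : Set A)] {a : A}
    (ha : a ∈ S) (hpos : ∃ b : A, a = star b * b) : ∃ b ∈ S, a = star b * b := by
  let _ := CStarAlgebra.spectralOrder A
  have := CStarAlgebra.spectralOrderedRing A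
  have h0 := CStarAlgebra.nonneg_iff_eq_star_mul_self.2 hpos
  refine ⟨CFC.sqrt a, ?_, ?_⟩
  · rw [CFC.sqrt_eq_real_sqrt a, cfcₙ_eq_cfc]
    exact cfc_mem (s := S) _ ha
  · have h1 : star (CFC.sqrt a) = CFC.sqrt a :=
      (IsSelfAdjoint.of_nonneg (CFC.sqrt_nonneg a)).star_eq
    rw [h1]
    exact CStarAlgebra.nonneg_iff_eq_sqrt_mul_sqrt.1 h0

theorem exists_sum_eq_star_mul_self {ι : Type*} (s : Finset ι) (a : ι → A)
    (h : ∀ i ∈ s, ∃ b : A, a i = star b * b) : ∃ b : A, ∑ i ∈ s, a i = star b * b := by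
  let _ := CStarAlgebra.spectralOrder A
  have := CStarAlgebra.spectralOrderedRing A
  exact CStarAlgebra.nonneg_iff_eq_star_mul_self.1
    (Finset.sum_nonneg fun i hi => CStarAlgebra.nonneg_iff_eq_star_mul_self.2 (h i hi))

end Generated

namespace DGraph

variable {G : DGraph}

namespace Relations

variable {A : Type u} [CStarAlgebra A] {q : G.Edge → A}

theorem isSelfAdjoint (h : G.Relations q) (e : G.Edge) : IsSelfAdjoint (q e) := by
  obtain ⟨b, hb⟩ := h.pos e
  rw [hb]
  exact IsSelfAdjoint.star_mul_self b

theorem norm_le_one (h : G.Relations q) (e : G.Edge) : ‖q e‖ ≤ 1 := by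
  let _ := CStarAlgebra.spectralOrder A
  have := CStarAlgebra.spectralOrderedRing A
  have h0 : ∀ e, 0 ≤ q e := fun e => CStarAlgebra.nonneg_iff_eq_star_mul_self.2 (h.pos e)
  rw [CStarAlgebra.norm_le_one_iff_of_nonneg (q e) (h0 e), ← h.sum_eq_one]
  exact Finset.single_le_sum (fun e _ => h0 e) (Finset.mem_univ e)

end Relations

/-! ### A universal algebra from a norm estimate -/

section NormEstimate

variable {P : Type u} [CStarAlgebra P]

/-- The domination of `p` by `Q` passes from polynomials to the closed graph. -/
theorem norm_snd_le_norm_fst {E : Type} {B : Type u} [CStarAlgebra B] {Q : E → P} {p : E → B}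
    (hQ : ∀ e, IsSelfAdjoint (Q e)) (hp : ∀ e, IsSelfAdjoint (p e))
    (hle : ∀ x, ‖FreeAlgebra.lift ℂ p x‖ ≤ ‖FreeAlgebra.lift ℂ Q x‖) {c : P × B}
    (hc : c ∈ (StarAlgebra.adjoin ℂ (Set.range fun e => (Q e, p e))).topologicalClosure) :
    ‖c.2‖ ≤ ‖c.1‖ := by
  have hclosed : IsClosed {c : P × B | ‖c.2‖ ≤ ‖c.1‖} :=
    isClosed_le continuous_snd.norm continuous_fst.norm
  refine closure_minimal (s := (StarAlgebra.adjoin ℂ (Set.range fun e => (Q e, p e)) :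
    Set (P × B))) ?_ hclosed hc
  rw [coe_adjoin_range_eq_range_lift fun e => Prod.ext (hQ e).star_eq (hp e).star_eq]
  rintro _ ⟨x, rfl⟩
  have h1 : (AlgHom.fst ℂ P B).comp (FreeAlgebra.lift ℂ fun e => (Q e, p e)) =
      FreeAlgebra.lift ℂ Q := by ext; simp
  have h2 : (AlgHom.snd ℂ P B).comp (FreeAlgebra.lift ℂ fun e => (Q e, p e)) =
      FreeAlgebra.lift ℂ p := by ext; simp
  have := hle x
  rw [← h1, ← h2] at this
  exact this

/-- A family `Q` whose polynomials dominate in norm the corresponding polynomials of `p` is mapped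
to `p` by a `*`-homomorphism. It is read off from its graph, the closed star subalgebra of `P × B`
generated by the pairs `(Q e, p e)`: the first projection is isometric on it. -/
theorem exists_starAlgHom_of_norm_le {E : Type} {B : Type u} [CStarAlgebra B] {Q : E → P}
    {p : E → B} (hQ : ∀ e, IsSelfAdjoint (Q e)) (hp : ∀ e, IsSelfAdjoint (p e))
    (hle : ∀ x, ‖FreeAlgebra.lift ℂ p x‖ ≤ ‖FreeAlgebra.lift ℂ Q x‖) :
    ∃ φ : (StarAlgebra.adjoin ℂ (Set.range Q)).topologicalClosure →⋆ₐ[ℂ] B,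
      ∀ e (he : Q e ∈ (StarAlgebra.adjoin ℂ (Set.range Q)).topologicalClosure),
        φ ⟨Q e, he⟩ = p e := by
  set C := (StarAlgebra.adjoin ℂ (Set.range fun e => (Q e, p e))).topologicalClosure
  set A := (StarAlgebra.adjoin ℂ (Set.range Q)).topologicalClosure
  have hmemC : ∀ e, (Q e, p e) ∈ C := fun e =>
    StarSubalgebra.le_topologicalClosure _ (StarAlgebra.subset_adjoin ℂ _ ⟨e, rfl⟩)
  have hmemA : ∀ e, Q e ∈ A := fun e =>
    StarSubalgebra.le_topologicalClosure _ (StarAlgebra.subset_adjoin ℂ _ ⟨e, rfl⟩)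
  have hAclosed : IsClosed (A : Set P) := StarSubalgebra.isClosed_topologicalClosure _
  have hCclosed : IsClosed (C : Set (P × B)) := StarSubalgebra.isClosed_topologicalClosure _
  have hfst : ∀ c : C, c.1.1 ∈ A := by
    have : C ≤ A.comap (StarAlgHom.fst ℂ P B) := by
      refine StarSubalgebra.topologicalClosure_minimal ?_ (hAclosed.preimage continuous_fst)
      refine StarAlgebra.adjoin_le ?_
      rintro _ ⟨e, rfl⟩
      exact hmemA e
    exact fun c => this c.2
  let π : C →⋆ₐ[ℂ] A := ((StarAlgHom.fst ℂ P B).comp C.subtype).codRestrict A hfst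
  have hnorm : ∀ c : C, ‖c.1.1‖ = ‖c‖ := fun c =>
    (max_eq_left (norm_snd_le_norm_fst hQ hp hle c.2)).symm
  have hiso : Isometry (fun c : C => c.1.1) := by
    refine Isometry.of_dist_eq fun c d => ?_
    rw [dist_eq_norm, dist_eq_norm, ← hnorm (c - d)]
    rfl
  -- An isometry from a complete space has closed range, so the projection reaches all of `A`.
  have hsurj : ∀ a ∈ A, ∃ c : C, c.1.1 = a := by
    have : CompleteSpace C := hCclosed.completeSpace_coe
    have hle' : A ≤ ((StarAlgHom.fst ℂ P B).comp C.subtype).range := by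
      refine StarSubalgebra.topologicalClosure_minimal ?_ ?_
      · refine StarAlgebra.adjoin_le ?_
        rintro _ ⟨e, rfl⟩
        exact ⟨⟨_, hmemC e⟩, rfl⟩
      · have := hiso.isClosedEmbedding.isClosed_range
        convert this using 1
        ext a
        exact Iff.rfl
    exact fun a ha => hle' ha
  have hbij : Function.Bijective π := by
    refine ⟨fun c d h => hiso.injective (congrArg Subtype.val h), fun a => ?_⟩
    obtain ⟨c, hc⟩ := hsurj a.1 a.2
    exact ⟨c, Subtype.ext hc⟩
  let ε := StarAlgEquiv.ofBijective π hbij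
  refine ⟨((StarAlgHom.snd ℂ P B).comp C.subtype).comp (ε.symm : A →⋆ₐ[ℂ] C), fun e he => ?_⟩
  have h1 : ε ⟨(Q e, p e), hmemC e⟩ = ⟨Q e, he⟩ := rfl
  have h2 : ε.symm ⟨Q e, he⟩ = ⟨(Q e, p e), hmemC e⟩ := by
    rw [← h1, StarAlgEquiv.symm_apply_apply]
  change (ε.symm ⟨Q e, he⟩).1.2 = p e
  rw [h2]

end NormEstimate

/-! ### The universal algebra of a graph -/

/-- A representation of the relations of `G` in a nonzero C*-algebra in the universe `u`. Nonzero,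
so that the unit has norm `1`, as the ring structure on `lp _ ∞` requires; nothing is lost, since
every polynomial vanishes in the zero algebra. -/
structure Rep (G : DGraph) where
  carrier : Type u
  [cstarAlgebra : CStarAlgebra carrier]
  [nontrivial : Nontrivial carrier]
  gen : G.Edge → carrier
  relations : G.Relations gen

attribute [instance] Rep.cstarAlgebra Rep.nontrivial

/-- The norm that a representation induces on noncommutative polynomials in the generators. -/
noncomputable def Rep.polyNorm (R : Rep.{u} G) (x : FreeAlgebra ℂ G.Edge) : ℝ :=
  ‖FreeAlgebra.lift ℂ R.gen x‖

variable (G) in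
/-- The norms on noncommutative polynomials that are induced by representations. They form a small
type, although representations do not. -/
abbrev RepNorm : Type := Set.range (Rep.polyNorm.{u} (G := G))

/-- A representation which induces the given norm. -/
noncomputable def RepNorm.rep (N : RepNorm.{u} G) : Rep.{u} G := N.2.choose

theorem RepNorm.polyNorm_rep (N : RepNorm.{u} G) : N.rep.polyNorm = N.1 := N.2.choose_spec

variable (G) in
/-- The product of one representation for each of the possible norms. -/
abbrev RepProd : Type u := lp (fun N : RepNorm.{u} G => N.rep.carrier) ∞

noncomputable instance : CStarAlgebra (RepProd.{u} G) where

variable (G) in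
/-- The generators in the product of representations. -/
noncomputable def prodGen (e : G.Edge) : RepProd.{u} G :=
  ⟨fun N => N.rep.gen e, memℓp_infty ⟨1, by
    rintro _ ⟨N, rfl⟩
    exact N.rep.relations.norm_le_one e⟩⟩

/-- Evaluation at one coordinate of the product. -/
noncomputable def evalRep (N : RepNorm.{u} G) : RepProd.{u} G →⋆ₐ[ℂ] N.rep.carrier where
  toFun f := f N
  map_one' := rfl
  map_mul' _ _ := rfl
  map_zero' := rfl
  map_add' _ _ := rfl
  commutes' _ := rfl
  map_star' _ := rfl

theorem relations_prodGen : G.Relations (prodGen.{u} G) where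
  pos e := by
    choose b hb using fun N : RepNorm.{u} G => N.rep.relations.pos e
    have hbn : ∀ N, ‖b N‖ ≤ 1 := fun N => by
      have h1 := N.rep.relations.norm_le_one e
      rw [hb N, CStarRing.norm_star_mul_self] at h1
      nlinarith [norm_nonneg (b N)]
    exact ⟨⟨b, memℓp_infty ⟨1, by rintro _ ⟨N, rfl⟩; exact hbn N⟩⟩, Subtype.ext (funext hb)⟩
  sum_eq_one := by
    refine Subtype.ext (funext fun N => ?_)
    have h : evalRep N (∑ e, prodGen G e) = evalRep N 1 := by
      rw [map_sum, map_one]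
      exact N.rep.relations.sum_eq_one
    exact h
  prod_eq_zero l hl := by
    refine Subtype.ext (funext fun N => ?_)
    have h : evalRep N (l.map (prodGen G)).prod = evalRep N 0 := by
      rw [map_list_prod, map_zero, List.map_map]
      exact N.rep.relations.prod_eq_zero l hl
    exact h

/-- The norm of a polynomial in the generators of the product is the largest possible one. -/
theorem norm_lift_le_norm_lift_prodGen {B : Type u} [CStarAlgebra B] {p : G.Edge → B}
    (hp : G.Relations p) (x : FreeAlgebra ℂ G.Edge) :
    ‖FreeAlgebra.lift ℂ p x‖ ≤ ‖FreeAlgebra.lift ℂ (prodGen.{u} G) x‖ := by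
  rcases subsingleton_or_nontrivial B with _ | _
  · rw [Subsingleton.elim (FreeAlgebra.lift ℂ p x) 0, norm_zero]
    exact norm_nonneg _
  · let R : Rep.{u} G := ⟨B, p, hp⟩
    let N : RepNorm.{u} G := ⟨R.polyNorm, R, rfl⟩
    have h1 : ‖FreeAlgebra.lift ℂ p x‖ = ‖FreeAlgebra.lift ℂ N.rep.gen x‖ :=
      (congrFun N.polyNorm_rep x).symm
    have h2 : (evalRep N : RepProd.{u} G →ₐ[ℂ] N.rep.carrier).comp
        (FreeAlgebra.lift ℂ (prodGen G)) = FreeAlgebra.lift ℂ N.rep.gen := by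
      ext e
      simp
      rfl
    rw [h1, ← h2]
    exact lp.norm_apply_le_norm ENNReal.top_ne_zero (FreeAlgebra.lift ℂ (prodGen.{u} G) x) N

variable (G) in
/-- The closed star subalgebra of the product that is generated by `prodGen G`. -/
noncomputable def universalSubalgebra : StarSubalgebra ℂ (RepProd.{u} G) :=
  (StarAlgebra.adjoin ℂ (Set.range (prodGen G))).topologicalClosure

instance : IsClosed (universalSubalgebra.{u} G : Set (RepProd.{u} G)) :=
  StarSubalgebra.isClosed_topologicalClosure _

theorem prodGen_mem (e : G.Edge) : prodGen.{u} G e ∈ universalSubalgebra.{u} G :=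
  StarSubalgebra.le_topologicalClosure _ (StarAlgebra.subset_adjoin ℂ _ ⟨e, rfl⟩)

variable (G) in
/-- The universal unital C*-algebra of the graph `G`. -/
def UniversalAlg : Type u := universalSubalgebra.{u} G

noncomputable instance : CStarAlgebra (UniversalAlg.{u} G) :=
  inferInstanceAs (CStarAlgebra (universalSubalgebra.{u} G))

variable (G) in
/-- The inclusion of the universal algebra into the product of representations. -/
noncomputable def universalIncl : UniversalAlg.{u} G →⋆ₐ[ℂ] RepProd.{u} G :=
  (universalSubalgebra G).subtype

theorem universalIncl_injective : Function.Injective (universalIncl.{u} G) :=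
  Subtype.val_injective

variable (G) in
/-- The generators of the universal algebra. -/
noncomputable def universalGen (e : G.Edge) : UniversalAlg.{u} G :=
  ⟨prodGen G e, prodGen_mem e⟩

instance : TopologicalSpace.SeparableSpace (UniversalAlg.{u} G) :=
  (isSeparable_topologicalClosure_adjoin relations_prodGen.isSelfAdjoint).separableSpace

theorem relations_universalGen : G.Relations (universalGen.{u} G) where
  pos e := by
    obtain ⟨b, hb, h⟩ := exists_mem_eq_star_mul_self _ (prodGen_mem.{u} e)
      (relations_prodGen.pos e)
    exact ⟨⟨b, hb⟩, Subtype.ext h⟩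
  sum_eq_one := by
    apply universalIncl_injective
    rw [map_sum, map_one]
    exact relations_prodGen.sum_eq_one
  prod_eq_zero l hl := by
    apply universalIncl_injective
    rw [map_list_prod, List.map_map, map_zero]
    exact relations_prodGen.prod_eq_zero l hl

open scoped CStarAlgebra in
theorem isUniversal_universalGen : G.IsUniversal (universalGen.{u} G) where
  relations := relations_universalGen
  existsUnique B _ p hp := by
    obtain ⟨φ, hφ⟩ : ∃ φ : UniversalAlg.{u} G →⋆ₐ[ℂ] B,
        ∀ e he, φ ⟨prodGen G e, he⟩ = p e :=
      exists_starAlgHom_of_norm_le relations_prodGen.isSelfAdjoint hp.isSelfAdjoint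
        (norm_lift_le_norm_lift_prodGen hp)
    refine ⟨φ, fun e => hφ e (prodGen_mem e), fun ψ hψ => ?_⟩
    have hψc : Continuous ψ := map_continuous ψ
    have hφc : Continuous φ := map_continuous φ
    refine StarAlgHom.ext_topologicalClosure hψc hφc ?_
    refine StarAlgHom.ext_adjoin ?_
    rintro ⟨_, hx⟩ ⟨e, rfl⟩
    exact (hψ e).trans (hφ e (prodGen_mem e)).symm

theorem Relations.map {A : Type u} {B : Type v} [CStarAlgebra A] [CStarAlgebra B]
    {q : G.Edge → A} (h : G.Relations q) (φ : A →⋆ₐ[ℂ] B) : G.Relations fun e => φ (q e) where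
  pos e := by
    obtain ⟨b, hb⟩ := h.pos e
    exact ⟨φ b, by rw [hb, map_mul, map_star]⟩
  sum_eq_one := by rw [← map_sum, h.sum_eq_one, map_one]
  prod_eq_zero l hl := by
    have := congrArg φ (h.prod_eq_zero l hl)
    rwa [map_list_prod, map_zero, List.map_map] at this

theorem IsUniversal.hom_ext {A B : Type u} [CStarAlgebra A] [CStarAlgebra B] {q : G.Edge → A}
    (hq : G.IsUniversal q) {φ ψ : A →⋆ₐ[ℂ] B} (h : ∀ e, φ (q e) = ψ (q e)) : φ = ψ :=
  (hq.existsUnique B _ (hq.relations.map ψ)).unique h fun _ => rfl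

/-! ### Maps of graphs that preserve paths -/

/-- If `t` sends the edges of any path in `G` to edges of a path in `H`, then summing generators
over the fibres of `t` turns a solution of the relations of `G` into one of those of `H`. -/
theorem Relations.pushforward {G H : DGraph} {A : Type u} [CStarAlgebra A] {q : G.Edge → A}
    [DecidableEq H.Edge] (hq : G.Relations q) (t : G.Edge → H.Edge)
    (ht : ∀ μ, G.IsPath μ → ∃ ν, H.IsPath ν ∧ ∀ e ∈ μ, t e ∈ ν) :
    H.Relations fun e => ∑ f with t f = e, q f where
  pos e := exists_sum_eq_star_mul_self _ _ fun f _ => hq.pos f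
  sum_eq_one := by
    rw [Finset.sum_fiberwise]
    exact hq.sum_eq_one
  prod_eq_zero l hl := by
    -- Expand the product one factor at a time; `m` lists the summands chosen so far.
    have key : ∀ (l : List H.Edge) (m : List G.Edge),
        (¬ ∃ ν, H.IsPath ν ∧ ∀ e ∈ m.map t ++ l, e ∈ ν) →
        (m.map q).prod * (l.map fun e => ∑ f with t f = e, q f).prod = 0 := by
      intro l
      induction l with
      | nil =>
        intro m hm
        rw [hq.prod_eq_zero m, zero_mul]
        rintro ⟨μ, hμ, hsub⟩
        obtain ⟨ν, hν, hsub'⟩ := ht μ hμ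
        refine hm ⟨ν, hν, fun e he => ?_⟩
        rw [List.append_nil] at he
        obtain ⟨f, hf, rfl⟩ := List.mem_map.1 he
        exact hsub' f (hsub f hf)
      | cons e l ih =>
        intro m hm
        rw [List.map_cons, List.prod_cons, ← mul_assoc, Finset.mul_sum, Finset.sum_mul]
        refine Finset.sum_eq_zero fun f hf => ?_
        have := ih (m ++ [f]) (by simpa [(Finset.mem_filter.1 hf).2] using hm)
        simpa using this
    simpa using key l [] (by simpa using hl)

end DGraph

/-! ### Morphisms of trees preserve paths -/

namespace RTree

variable {S T : RTree}

/-- `T.Above a b` holds if the edge `b` is reached from the edge `a` by going down `T`, that is, if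
`b` lies on the way from `a` to the root. -/
def Above (T : RTree) : T.Edge → T.Edge → Prop :=
  Relation.ReflTransGen fun a b => ∃ x, T.bot a = some x ∧ T.out x = b

/-- The inputs of an operation of `Ω[T]` lie above its output. -/
theorem Expr.above {I : Type} [Finite I] {c : I → T.Edge} {d : T.Edge} (p : T.Expr c d) :
    ∀ i, T.Above (c i) d := by
  induction p with
  | one d => exact fun _ => .refl
  | vertex x => exact fun e => .single ⟨x, e.2, rfl⟩
  | relabel σ p ih => exact fun j => ih (σ j)
  | comp p q ih ih' => exact fun x => (ih' x.1 x.2).trans (ih x.1)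

theorem above_onEdges (τ : S ⟶ T) {x : S.Vertex} {e : S.Edge} (he : S.bot e = some x) :
    T.Above (onEdges τ e) (onEdges τ (S.out x)) :=
  (Quotient.out (SymOperad.Hom.op τ (I := S.Inputs x)
    (Quotient.mk (S.exprSetoid _ _) (Expr.vertex x)))).above ⟨e, he⟩

/-- Consecutive edges in a path of the modified tree meet in a vertex of `T`: the source of an edge
is never the added bottom vertex, and the range of an edge never an added tip. -/
theorem modified_src_eq_rng_iff {e f : T.Edge} :
    T.modified.src e = T.modified.rng f ↔ ∃ x, T.bot f = some x ∧ T.out x = e := by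
  constructor
  · intro h
    dsimp only at h
    split at h <;> split at h
    · rename_i x hx _ y hy
      cases h
      exact ⟨x, hy, (T.top_eq_some _ _).1 hx⟩
    · cases h
    · cases h
    · cases h
  · rintro ⟨x, hx, rfl⟩
    have := T.top_out x
    dsimp only
    split
    · rename_i y hy
      rw [hx]
      rw [this] at hy
      cases hy
      rfl
    · rename_i hy
      rw [this] at hy
      cases hy

/-- If `a` lies above `b`, then the edges from `b` up to `a` can be prepended to a path that starts
with `a`. -/
theorem Above.exists_isPath {a b : T.Edge} (h : T.Above a b) {μ : List T.Edge}
    (hμ : T.modified.IsPath (a :: μ)) :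
    ∃ ν, T.modified.IsPath (b :: ν) ∧ ∀ e ∈ a :: μ, e ∈ b :: ν := by
  induction h with
  | refl => exact ⟨μ, hμ, fun _ => id⟩
  | @tail b c _ hs ih =>
    obtain ⟨ν, hν, hsub⟩ := ih
    exact ⟨b :: ν, List.isChain_cons_cons.2 ⟨modified_src_eq_rng_iff.2 hs, hν⟩,
      fun e he => List.mem_cons_of_mem _ (hsub e he)⟩

/-- A morphism of trees sends the edges of a path to edges of a path. -/
theorem exists_isPath_onEdges (τ : S ⟶ T) {μ : List S.Edge} (hμ : S.modified.IsPath μ) :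
    ∃ ν, T.modified.IsPath ν ∧ ∀ e ∈ μ, onEdges τ e ∈ ν := by
  suffices h : ∀ (μ : List S.Edge) (e : S.Edge), S.modified.IsPath (e :: μ) →
      ∃ ν, T.modified.IsPath (onEdges τ e :: ν) ∧ ∀ f ∈ e :: μ, onEdges τ f ∈ onEdges τ e :: ν by
    cases μ with
    | nil => exact ⟨[], .nil, by simp⟩
    | cons e μ =>
      obtain ⟨ν, h1, h2⟩ := h μ e hμ
      exact ⟨_, h1, h2⟩
  intro μ
  induction μ with
  | nil => exact fun e _ => ⟨[], .singleton _, by simp⟩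
  | cons f μ ih =>
    intro e he
    obtain ⟨hef, hf⟩ := List.isChain_cons_cons.1 he
    obtain ⟨ν, hν, hsub⟩ := ih f hf
    obtain ⟨x, hx, rfl⟩ := modified_src_eq_rng_iff.1 hef
    obtain ⟨ν', hν', hsub'⟩ := (above_onEdges τ hx).exists_isPath hν
    refine ⟨ν', hν', ?_⟩
    rintro g (_ | ⟨_, hg⟩)
    · exact List.mem_cons_self
    · exact hsub' _ (hsub g hg)

end RTree

/-! ### The dendrex functor -/

namespace RTree

variable {S T : RTree}

/-- The relations have a solution in the nonzero algebra of functions on a point: the generator of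
one edge is `1` and the others are `0`. -/
theorem relations_single [DecidableEq T.Edge] (e : T.Edge) :
    T.modified.Relations fun f => if f = e then (1 : C(PUnit.{u + 1}, ℂ)) else 0 where
  pos f := ⟨if f = e then 1 else 0, by split_ifs <;> simp⟩
  sum_eq_one := by simp
  prod_eq_zero l hl := by
    -- The path consisting of `e` alone supports all products whose factors belong to `e`.
    have h : ∃ f ∈ l, f ≠ e := by
      by_contra! h
      exact hl ⟨[e], .singleton _, fun f hf => List.mem_singleton.2 (h f hf)⟩
    obtain ⟨f, hf, hne⟩ := h
    exact List.prod_eq_zero (List.mem_map.2 ⟨f, hf, if_neg hne⟩)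

variable (T) in
/-- The algebra `D(T)` of a tree. -/
abbrev DendrexAlg : Type u := DGraph.UniversalAlg.{u} T.modified

variable (T) in
/-- The generators of `D(T)`. -/
noncomputable abbrev dendrexGen : T.Edge → DendrexAlg.{u} T := DGraph.universalGen T.modified

instance : Nontrivial (DendrexAlg.{u} T) := by
  classical
  obtain ⟨φ, -, -⟩ := DGraph.isUniversal_universalGen.existsUnique _ _ (relations_single T.root)
  exact (φ : DendrexAlg.{u} T →+* C(PUnit.{u + 1}, ℂ)).domain_nontrivial

open scoped Classical in
theorem existsUnique_dendrexMap (τ : S ⟶ T) :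
    ∃! φ : DendrexAlg.{u} T →⋆ₐ[ℂ] DendrexAlg.{u} S,
      ∀ e, φ (dendrexGen T e) = ∑ f with onEdges τ f = e, dendrexGen S f :=
  DGraph.isUniversal_universalGen.existsUnique _ _
    (DGraph.Relations.pushforward (G := S.modified) (H := T.modified)
      DGraph.relations_universalGen (onEdges τ) fun _ => exists_isPath_onEdges τ)

/-- The map `τ^* : D(T) → D(S)` induced by a morphism of trees `τ : S ⟶ T`. -/
noncomputable def dendrexMap (τ : S ⟶ T) : DendrexAlg.{u} T →⋆ₐ[ℂ] DendrexAlg.{u} S :=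
  (existsUnique_dendrexMap τ).choose

open scoped Classical in
theorem dendrexMap_gen (τ : S ⟶ T) (e : T.Edge) :
    dendrexMap.{u} τ (dendrexGen T e) = ∑ f with onEdges τ f = e, dendrexGen S f :=
  (existsUnique_dendrexMap τ).choose_spec.1 e

theorem dendrexHom_ext {B : Type u} [CStarAlgebra B] {φ ψ : DendrexAlg.{u} T →⋆ₐ[ℂ] B}
    (h : ∀ e, φ (dendrexGen T e) = ψ (dendrexGen T e)) : φ = ψ :=
  DGraph.isUniversal_universalGen.hom_ext h

open scoped Classical in
/-- If `τ` maps exactly one edge to `e`, then the sum in the formula for `τ^*` has one term. -/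
theorem sum_fiber_eq_gen (τ : S ⟶ T) {e : T.Edge} (f : S.Edge)
    (h : ∀ a, onEdges τ a = e ↔ a = f) :
    ∑ a with onEdges τ a = e, dendrexGen.{u} S a = dendrexGen S f := by
  rw [Finset.filter_congr fun a _ => h a, Finset.sum_filter, Finset.sum_ite_eq',
    if_pos (Finset.mem_univ f)]

open scoped Classical in
theorem sum_fiber_eq_zero (τ : S ⟶ T) {e : T.Edge} (h : ∀ a, onEdges τ a ≠ e) :
    ∑ a with onEdges τ a = e, dendrexGen.{u} S a = 0 := by
  simp [h]

theorem dendrexMap_id (T : RTree) : dendrexMap.{u} (𝟙 T) = StarAlgHom.id ℂ _ := by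
  classical
  refine dendrexHom_ext fun e => ?_
  rw [dendrexMap_gen]
  exact sum_fiber_eq_gen _ _ fun a => Iff.rfl

theorem dendrexMap_comp {R : RTree} (σ : R ⟶ S) (τ : S ⟶ T) :
    dendrexMap.{u} (σ ≫ τ) = (dendrexMap σ).comp (dendrexMap τ) := by
  classical
  refine dendrexHom_ext fun e => ?_
  rw [StarAlgHom.comp_apply, dendrexMap_gen, dendrexMap_gen, map_sum]
  simp_rw [dendrexMap_gen]
  have h : ∀ f, onEdges (σ ≫ τ) f = onEdges τ (onEdges σ f) := fun _ => rfl
  simp_rw [h]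
  -- The fibre of `σ ≫ τ` over `e` is partitioned by the values of `σ`.
  refine ((Finset.sum_fiberwise_of_maps_to (g := onEdges σ) (fun f hf => ?_) _).symm.trans
    (Finset.sum_congr rfl fun g hg => ?_))
  · simpa using hf
  · refine Finset.sum_congr (Finset.ext fun f => ?_) fun _ _ => rfl
    have := (Finset.mem_filter.1 hg).2
    simp only [Finset.mem_filter, Finset.mem_univ, true_and, and_iff_right_iff_imp]
    rintro rfl
    exact this

/-- The functor `D`, with `D(T)` the universal algebra of the modified tree. -/
noncomputable def dendrex : RTree ⥤ SCUn.{u}ᵒᵖ where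
  obj T := .op ⟨DendrexAlg T⟩
  map τ := Quiver.Hom.op ⟨dendrexMap τ⟩
  map_id T := by
    rw [dendrexMap_id]
    rfl
  map_comp σ τ := by
    rw [dendrexMap_comp]
    rfl

open scoped Classical in
theorem onEdges_degeneracy_eq_iff {x : T.Vertex} {e : T.Edge} (he : T.bot e = some x)
    (hu : ∀ a, T.bot a = some x → a = e) (a : T.Edge) {f : T.Edge} (hf : f ≠ e) :
    onEdges (degeneracy he hu) a = ⟨f, hf⟩ ↔ (if a = e then T.out x else a) = f := by
  refine Subtype.ext_iff.trans ?_
  change (dite (a = e) _ _ : {a : T.Edge // a ≠ e}).1 = f ↔ _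
  split_ifs <;> rfl

end RTree
end Dendroidal

open Dendroidal Dendroidal.RTree Opposite in
open scoped Classical in
theorem proposition2p5 :
    ∃ (D : RTree ⥤ SCUn.{u}ᵒᵖ) (q : (T : RTree) → T.Edge → (unop (D.obj T) : SCUn.{u})),
      -- `D(T)` is the noncommutative dendrex of `T`, with generators `q T e`
      (∀ T : RTree, T.modified.IsUniversal (q T)) ∧
      -- inner faces
      (∀ (T : RTree) (e : T.Edge) (x y : T.Vertex) (hx : T.top e = some x) (hy : T.bot e = some y),
        (∀ (f : T.Edge) (hf : f ≠ e),
          (D.map (innerFace hx hy)).unop.hom (q T f) = q (contract hx hy) ⟨f, hf⟩) ∧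
        (D.map (innerFace hx hy)).unop.hom (q T e) = 0) ∧
      -- outer faces
      (∀ (T : RTree) (x : T.Vertex) (hx : ∃! a, T.IsInner a ∧ T.IsAttached a x),
        (∀ (f : T.Edge) (hf : T.IsAttached f x → T.IsInner f),
          (D.map (outerFace hx)).unop.hom (q T f) = q (prune hx) ⟨f, hf⟩) ∧
        (∀ f : T.Edge, T.IsAttached f x → ¬ T.IsInner f →
          (D.map (outerFace hx)).unop.hom (q T f) = 0)) ∧
      -- inclusions of edges (the outer faces of corollas)
      (∀ (T : RTree) (e : T.Edge),
        (D.map (edgeMap e)).unop.hom (q T e) = q unitTree () ∧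
        (∀ f : T.Edge, f ≠ e → (D.map (edgeMap e)).unop.hom (q T f) = 0)) ∧
      -- degeneracies
      (∀ (T : RTree) (x : T.Vertex) (e : T.Edge) (he : T.bot e = some x)
        (hu : ∀ a, T.bot a = some x → a = e),
        (D.map (degeneracy he hu)).unop.hom (q (merge he hu) ⟨T.out x, T.out_ne he⟩) =
          q T e + q T (T.out x) ∧
        (∀ (f : T.Edge) (hf : f ≠ e), f ≠ T.out x →
          (D.map (degeneracy he hu)).unop.hom (q (merge he hu) ⟨f, hf⟩) = q T f)) ∧
      -- isomorphisms
      (∀ (S T : RTree) (θ : S ≅ T) (e : T.Edge),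
        (D.map θ.hom).unop.hom (q T e) = q S (onEdges θ.inv e)) ∧
      -- arbitrary morphisms
      (∀ (S T : RTree) (τ : S ⟶ T) (e : T.Edge),
        (D.map τ).unop.hom (q T e) = ∑ f with onEdges τ f = e, q S f) := by
  refine ⟨dendrex, dendrexGen, fun T => DGraph.isUniversal_universalGen, ?_, ?_, ?_, ?_, ?_,
    fun S T τ e => dendrexMap_gen τ e⟩
  · intro T e x y hx hy
    refine ⟨fun f hf => (dendrexMap_gen _ f).trans (sum_fiber_eq_gen _ _ fun a => ?_),
      (dendrexMap_gen _ e).trans (sum_fiber_eq_zero _ fun a => a.2)⟩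
    exact ⟨fun h => Subtype.ext h, fun h => congrArg Subtype.val h⟩
  · intro T x hx
    refine ⟨fun f hf => (dendrexMap_gen _ f).trans (sum_fiber_eq_gen _ _ fun a => ?_),
      fun f hf hf' => (dendrexMap_gen _ f).trans (sum_fiber_eq_zero _ fun a h => ?_)⟩
    · exact ⟨fun h => Subtype.ext h, fun h => congrArg Subtype.val h⟩
    · have h : a.1 = f := h
      subst h
      exact hf' (a.2 hf)
  · intro T e
    refine ⟨(dendrexMap_gen _ e).trans (sum_fiber_eq_gen _ _ fun a => ?_),
      fun f hf => (dendrexMap_gen _ f).trans (sum_fiber_eq_zero _ fun a => hf.symm)⟩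
    exact ⟨fun _ => rfl, fun _ => rfl⟩
  · intro T x e he hu
    refine ⟨(dendrexMap_gen _ _).trans ?_,
      fun f hf hf' => (dendrexMap_gen _ _).trans (sum_fiber_eq_gen _ _ fun a => ?_)⟩
    · refine (Finset.sum_congr (Finset.ext fun a => ?_) fun _ _ => rfl).trans
        (Finset.sum_pair (T.out_ne he).symm)
      rw [Finset.mem_filter, onEdges_degeneracy_eq_iff, Finset.mem_insert, Finset.mem_singleton]
      by_cases h : a = e <;> simp [h]
    · rw [onEdges_degeneracy_eq_iff]
      by_cases h : a = e
      · rw [if_pos h, h]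
        exact ⟨fun h' => (hf' h'.symm).elim, fun h' => (hf h'.symm).elim⟩
      · rw [if_neg h]
  · intro S T θ e
    refine (dendrexMap_gen _ _).trans (sum_fiber_eq_gen _ _ fun a => ?_)
    have h1 : ∀ a, onEdges θ.inv (onEdges θ.hom a) = a :=
      fun a => congrArg (fun τ => onEdges τ a) θ.hom_inv_id
    have h2 : ∀ a, onEdges θ.hom (onEdges θ.inv a) = a :=
      fun a => congrArg (fun τ => onEdges τ a) θ.inv_hom_id
    exact ⟨fun h => by rw [← h, h1], fun h => by rw [h, h2]⟩
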